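/- **Setting.** A *4-valent virtual graph* $G$ is a finite 4-valent graph (loops and multiple edges allowed, not necessarily connected) immersed in the oriented plane, the crossings of edges away from the vertices ("virtual double points") being ignored; thus the only structure besides the graph itself is the counterclockwise cyclic order of the four half-edges at each vertex. A *checkerboard coloring* of $G$ colors one side of each edge so that around every vertex the four corners are alternately colored and uncolored. A coloring directs every edge so that its colored side lies on its left; incoming and outgoing half-edges then alternate around each vertex, and $G$ becomes a *2-digraph*. $G$ is *vertex-signed* if each vertex carries a sign $\pm$; signs are understood relative to the coloring: when the coloring is replaced by another one, the sign of $v$ is reversed if the colored and the uncolored corners at $v$ are exchanged, and kept otherwise. Let $G$ be colored, vertex-signed and connected, with vertices labeled $v_1,\dots,v_n$. An Euler circuit $\gamma$ is a closed directed path through each edge exactly once, up to the choice of the starting point. It visits each vertex twice, each time turning from an incoming half-edge to an adjacent outgoing one. The marker of $v_i$ connects the two strands of $\gamma$ at $v_i$. It lies either on the colored side of $\gamma$ (when the corners cut off by the two strands are the uncolored ones) or on the uncolored side. It is labeled $A$ (sign $+$, colored side), $a$ (sign $+$, uncolored side), $B$ (sign $-$, colored side) or $b$ (sign $-$, uncolored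 side). Distinct vertices $v_i,v_j$ *interlace* in $\gamma$ if $\gamma$ visits them in the cyclic order $v_i\dots v_j\dots v_i\dots v_j$. The vertex $v_i$ is *live* if $j>i$ for all $v_j$ that interlace with $v_i$, and *dead* otherwise. The weight $\mu_i(\gamma)$ is given by | marker of $v_i$ | $A$ | $a$ | $B$ | $b$ | |---|---|---|---|---| | live | $-q^{-3}$ | $-q^{3}$ | $-q^{3}$ | $-q^{-3}$ | | dead | $q$ | $q^{-1}$ | $q^{-1}$ | $q$ | and $X_G(q)=\sum_{\gamma}\prod_{i=1}^n\mu_i(\gamma)\in\mathbb Z[q,q^{-1}]$, the sum being over all Euler circuits of $G$. If $G$ has connected components $G_1,\dots,G_m$, put $X_G(q)=\bigl(-(q^2+q^{-2})\bigr)^{m-1}\prod_{i=1}^m X_{G_i}(q)$, each $G_i$ with the induced coloring, signs and order of the vertices. **Theorem.** Let $G$ be a vertex-signed checkerboard-colorable 2-digraph. Then $X_G(q)$ does not depend on the labeling (ordering) of the vertices, nor on the chosen checkerboard coloring (the signs being taken relative to the coloring, as above). It is moreover an invariant of the isomorphism class of $G$: $X_G(q)=X_{H}(q)$, for arbitrary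 labelings, whenever there is an isomorphism of graphs $G\to H$ that at each vertex preserves or reverses the cyclic order of the half-edges, and that preserves the signs and takes colored corners to colored corners. -/

import Mathlib

/-- A 4-valent virtual graph with vertex set `V`, recorded combinatorially.  The half-edge `(v, k)`
is the `k`-th one at `v` in the counterclockwise order of the plane, starting from an arbitrary one,
so `(v, k)` and `(v, k + 2)` are opposite.  `mate` sends a half-edge to the other end of its edge.
Virtual double points carry no data.  Loops and multiple edges are allowed, and the graph need not
be connected. -/
structure VirtualGraph (V : Type*) where
  mate : V × ZMod 4 → V × ZMod 4
  mate_mate : ∀ d, mate (mate d) = d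
  mate_ne : ∀ d, mate d ≠ d

/-- Underlying adjacency of distinct vertices; used only for connected components. -/
def VirtualGraph.adjGraph {V : Type*} (G : VirtualGraph V) : SimpleGraph V where
  Adj u v := u ≠ v ∧ ∃ k : ZMod 4, (G.mate (u, k)).1 = v
  symm := ⟨by
    rintro u v ⟨h, k, rfl⟩
    refine ⟨h.symm, (G.mate (u, k)).2, ?_⟩
    rw [Prod.mk.eta, G.mate_mate]⟩
  loopless := ⟨fun _ h => h.1 rfl⟩

/-- The connected components of `G` (as labels; see `VirtualGraph.component`). -/
abbrev VirtualGraph.Component {V : Type*} (G : VirtualGraph V) : Type _ :=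
  G.adjGraph.ConnectedComponent

theorem VirtualGraph.mate_mem {V : Type*} (G : VirtualGraph V) (K : G.Component)
    (d : V × ZMod 4) (h : d.1 ∈ K.supp) : (G.mate d).1 ∈ K.supp := by
  by_cases hd : d.1 = (G.mate d).1
  · rwa [← hd]
  · exact K.mem_supp_of_adj_mem_supp h ⟨hd, d.2, rfl⟩

/-- A connected component of `G`, as a virtual graph. -/
def VirtualGraph.component {V : Type*} (G : VirtualGraph V) (K : G.Component) :
    VirtualGraph K.supp where
  mate d := (⟨(G.mate (d.1.1, d.2)).1, G.mate_mem K (d.1.1, d.2) d.1.2⟩, (G.mate (d.1.1, d.2)).2)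
  mate_mate d := by
    apply Prod.ext
    · apply Subtype.ext
      simp [G.mate_mate]
    · simp [G.mate_mate]
  mate_ne d h := by
    apply G.mate_ne (d.1.1, d.2)
    apply Prod.ext
    · exact congrArg (fun x => x.1.1) h
    · exact congrArg (fun x => x.2) h

/-- A checkerboard coloring: one side of every edge is colored.  `left d` says that, looking from
the vertex outwards along the half-edge `d`, the colored side is the left (counterclockwise) one.
Seen from the other end of the edge left and right are interchanged.  Around a vertex the colored
and the uncolored corners alternate: the corner between positions `k` and `k + 1` is colored iff
`left (v, k)`. -/
structure VirtualGraph.Coloring {V : Type*} (G : VirtualGraph V) where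
  left : V × ZMod 4 → Bool
  left_mate : ∀ d, left (G.mate d) = !left d
  left_next : ∀ (v : V) (k : ZMod 4), left (v, k + 1) = !left (v, k)

namespace VirtualGraph.Coloring

variable {V : Type*} {G : VirtualGraph V}

/-- The corner between the adjacent half-edges `a` and `b` at a common vertex is colored. -/
def ColoredCorner (c : G.Coloring) (a b : V × ZMod 4) : Prop :=
  a.1 = b.1 ∧ ((b.2 = a.2 + 1 ∧ c.left a = true) ∨ (a.2 = b.2 + 1 ∧ c.left b = true))

/-- The coloring orients the edges: each edge is directed so that its colored side (that is, its
normal vector) is on its left.  An edge is given by its outgoing half-edge.  Around every vertex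
outgoing and incoming half-edges then alternate (source-target structure), so this is a 2-digraph. -/
def Edge (c : G.Coloring) : Type _ := {d : V × ZMod 4 // c.left d = true}

/-- The half-edge with which a directed edge starts. -/
def Edge.start {c : G.Coloring} (e : c.Edge) : V × ZMod 4 := e.1

/-- The half-edge with which a directed edge ends. -/
def Edge.finish {c : G.Coloring} (e : c.Edge) : V × ZMod 4 := G.mate e.1

/-- An Euler circuit of the directed graph: a closed directed path through every edge exactly once.
It is recorded as the cyclic permutation of the edges that sends each edge to the next one on the
circuit, so circuits that differ only in the starting point are identified. -/
structure EulerCircuit (c : G.Coloring) where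
  next : Equiv.Perm c.Edge
  isCycleOn : next.IsCycleOn Set.univ
  start_next : ∀ e, (next e).start.1 = e.finish.1

/-- Two distinct vertices interlace in `γ` if their chords cross in the chord diagram of `γ`, i.e.
the circuit visits them in the cyclic order `u … v … u … v …` during one turn. -/
def EulerCircuit.Interlaced {c : G.Coloring} (γ : c.EulerCircuit) (u v : V) : Prop :=
  u ≠ v ∧ ∃ (e : c.Edge) (i j k : ℕ), 0 < i ∧ i < j ∧ j < k ∧ k < Nat.card c.Edge ∧
    e.start.1 = u ∧ ((γ.next ^ i) e).start.1 = v ∧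
    ((γ.next ^ j) e).start.1 = u ∧ ((γ.next ^ k) e).start.1 = v

/-- `v` is live with respect to `γ`, for the labeling `ℓ` of the vertices: all vertices that
interlace with `v` have larger labels. -/
def EulerCircuit.Live {c : G.Coloring} (γ : c.EulerCircuit) (ℓ : V ↪ ℕ) (v : V) : Prop :=
  ∀ u, γ.Interlaced v u → ℓ v < ℓ u

/-- `γ` enters `v` at some position `k` and leaves it at position `k + 1`.  It then does so on both
visits and cuts off the two uncolored corners, so that the marker at `v`, which connects the two
strands of `γ`, lies on the colored side of them.  In the other case `γ` turns from `k` to `k - 1`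
on both visits and the marker lies on the uncolored side. -/
def EulerCircuit.MarkerColored {c : G.Coloring} (γ : c.EulerCircuit) (v : V) : Prop :=
  ∃ e : c.Edge, e.finish.1 = v ∧ (γ.next e).start.2 = e.finish.2 + 1

end VirtualGraph.Coloring

/-- Labels of markers. -/
inductive MarkerLabel
  | A | a | B | b

/-- Activity letters; `Lbar` stands for an overlined `L`, and so on. -/
inductive ActivityLetter
  | L | D | l | d | Lbar | Dbar | lbar | dbar

/-- The weight of an activity letter, a Laurent polynomial in `q = T 1`. -/
noncomputable def ActivityLetter.weight : ActivityLetter → LaurentPolynomial ℤ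
  | .L => -LaurentPolynomial.T (-3)
  | .D => LaurentPolynomial.T 1
  | .l => -LaurentPolynomial.T 3
  | .d => LaurentPolynomial.T (-1)
  | .Lbar => -LaurentPolynomial.T 3
  | .Dbar => LaurentPolynomial.T (-1)
  | .lbar => -LaurentPolynomial.T (-3)
  | .dbar => LaurentPolynomial.T 1

namespace VirtualGraph.Coloring

variable {V : Type*} {G : VirtualGraph V}

open Classical in
/-- The label of the marker at `v`; `s v` is the sign of `v`. -/
noncomputable def EulerCircuit.marker {c : G.Coloring} (γ : c.EulerCircuit) (s : V → ℤˣ) (v : V) :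
    MarkerLabel :=
  if s v = 1 then (if γ.MarkerColored v then .A else .a)
  else (if γ.MarkerColored v then .B else .b)

open Classical in
/-- The activity letter of `v` with respect to `γ`. -/
noncomputable def EulerCircuit.letter {c : G.Coloring} (γ : c.EulerCircuit) (s : V → ℤˣ)
    (ℓ : V ↪ ℕ) (v : V) : ActivityLetter :=
  match γ.marker s v with
  | .A => if γ.Live ℓ v then .L else .D
  | .B => if γ.Live ℓ v then .Lbar else .Dbar
  | .a => if γ.Live ℓ v then .l else .d
  | .b => if γ.Live ℓ v then .lbar else .dbar

/-- The weight of an Euler circuit: the product of the weights of all vertices. -/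
noncomputable def EulerCircuit.weight {c : G.Coloring} (γ : c.EulerCircuit) (s : V → ℤˣ)
    (ℓ : V ↪ ℕ) : LaurentPolynomial ℤ :=
  ∏ᶠ v : V, (γ.letter s ℓ v).weight

/-- The sum of the weights of all Euler circuits: the polynomial of a connected graph. -/
noncomputable def circuitSum (c : G.Coloring) (s : V → ℤˣ) (ℓ : V ↪ ℕ) : LaurentPolynomial ℤ :=
  ∑ᶠ γ : c.EulerCircuit, γ.weight s ℓ

/-- The restriction of a coloring to a connected component. -/
def component (c : G.Coloring) (K : G.Component) : (G.component K).Coloring where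
  left d := c.left (d.1.1, d.2)
  left_mate d := c.left_mate (d.1.1, d.2)
  left_next v k := c.left_next v.1 k

/-- The polynomial `X_G(q)` of a vertex-signed, checkerboard-colored 2-digraph whose vertices are
labeled by `ℓ`: `(-(q ^ 2 + q ^ (-2))) ^ (m - 1)` times the product of the polynomials of the `m`
connected components, each with the induced coloring, signs and order of the vertices. -/
noncomputable def X (c : G.Coloring) (s : V → ℤˣ) (ℓ : V ↪ ℕ) : LaurentPolynomial ℤ :=
  (-(LaurentPolynomial.T 2 + LaurentPolynomial.T (-2))) ^ (Nat.card G.Component - 1) *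
    ∏ᶠ K : G.Component, (c.component K).circuitSum (fun v => s v.1)
      ((Function.Embedding.subtype (· ∈ K.supp)).trans ℓ)

/-- Signs of vertices are relative to the coloring: if `s` gives the signs with respect to `c`, then
`recolorSign c c' s` gives the signs of the same vertices with respect to the coloring `c'`.  The
sign of `v` is reversed exactly when the colored and uncolored corners at `v` are exchanged. -/
def recolorSign (c c' : G.Coloring) (s : V → ℤˣ) (v : V) : ℤˣ :=
  if c'.left (v, 0) = c.left (v, 0) then s v else -s v

end VirtualGraph.Coloring

/-- An isomorphism of virtual graphs: a bijection of the vertices and, at every vertex, a bijection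
of the half-edges that preserves their cyclic order (`dir v = 1`) or reverses it (`dir v = -1`),
compatible with the edges. -/
structure VirtualGraph.Iso {V W : Type*} (G : VirtualGraph V) (H : VirtualGraph W) where
  vert : V ≃ W
  dir : V → (ZMod 4)ˣ
  shift : V → ZMod 4
  mate_map : ∀ (v w : V) (k l : ZMod 4), G.mate (v, k) = (w, l) →
    H.mate (vert v, dir v * k + shift v) = (vert w, dir w * l + shift w)

/-- The action of an isomorphism on half-edges. -/
def VirtualGraph.Iso.map {V W : Type*} {G : VirtualGraph V} {H : VirtualGraph W} (φ : G.Iso H)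
    (d : V × ZMod 4) : W × ZMod 4 :=
  (φ.vert d.1, φ.dir d.1 * d.2 + φ.shift d.1)

/-- The isomorphism takes the colored corners of `c` to those of `c'`. -/
def VirtualGraph.Iso.PreservesColoring {V W : Type*} {G : VirtualGraph V} {H : VirtualGraph W}
    (φ : G.Iso H) (c : G.Coloring) (c' : H.Coloring) : Prop :=
  ∀ a b : V × ZMod 4, c'.ColoredCorner (φ.map a) (φ.map b) ↔ c.ColoredCorner a b

/-!
The polynomial `X_G(q)` is the activity expansion of a Kauffman bracket.  A state `S` smooths every
vertex in one of the two ways compatible with the orientation of the edges; it has a weight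
`q ^ (±1)` at each vertex (`smoothingWeight`), and the value `δ = -(q ^ 2 + q ^ (-2))` for each of
its closed paths.  For a connected graph the sum over all states equals `δ` times the sum of the
weights of the Euler circuits (`circleValue_mul_circuitSum_of_linked`), for any labeling.

This expansion (`SmoothingFamily.stateSum_eq_mul_circuitExpansion`) is obtained by smoothing the
vertices in the order of decreasing labels.  If one smoothing of the current vertex disconnects the
graph formed by the vertices with smaller labels, each of its states has one closed path more than
the corresponding state of the other smoothing, so that the two smoothings combine into one term,
with the weight of a live vertex; otherwise both are kept, with the weight of a dead vertex.  That
these are the live and dead vertices of the definition follows from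
`SmoothingFamily.forall_sameCycle_iff_not_linked` and `EulerCircuit.interlaced_iff`: changing the
smoothing at `v` cuts an Euler circuit into two closed paths, each of which passes once through
every vertex that interlaces with `v`.

In the state sum neither the labeling nor the orientation of the edges plays a role: the number of
closed paths is the number of orbits of half-edges under passing along edges and turning at vertices
(`cycleCount_smoothing`), and the weight at a vertex only depends on which corners are cut off,
provided that the sign is reversed together with the colors of the corners.  An isomorphism, or a
change of coloring regarded as a twisted identity isomorphism, thus permutes the terms
(`RespectsUpTo.stateSum_eq`).  Applying this to the connected components and cancelling the nonzero
factor `δ` gives the theorem.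
-/

/-! ### Cycles of a permutation and transpositions -/

namespace VirtualGraph

section SwapCycles

open Equiv Equiv.Perm

variable {E : Type*}

/-- The number of cycles of a permutation, fixed points included. -/
noncomputable def cycleCount (σ : Perm E) : ℕ := Nat.card (Quotient (SameCycle.setoid σ))

theorem iff_of_sameCycle [Finite E] {σ : Perm E} {f : E → Prop} (hf : ∀ x, f (σ x) ↔ f x)
    {x y : E} (h : SameCycle σ x y) : f x ↔ f y := by
  obtain ⟨n, rfl⟩ := h.exists_nat_pow_eq
  clear h
  induction n with
  | zero => simp
  | succ n ih => rw [pow_succ', Perm.mul_apply, hf, ih]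

/-- If the orbit of `a` closes up after `n` steps without meeting `b`, then `b` is on another
cycle. -/
theorem not_sameCycle_of_return [Finite E] {σ : Perm E} {a b : E} {n : ℕ} (hn : 0 < n)
    (hret : (σ ^ n) a = a) (h : ∀ i < n, (σ ^ i) a ≠ b) : ¬ SameCycle σ a b := by
  intro hs
  obtain ⟨m, hm⟩ := hs.exists_nat_pow_eq
  apply h (m % n) (Nat.mod_lt _ hn)
  rw [← hm]
  conv_rhs => rw [← Nat.mod_add_div m n, pow_add, pow_mul, Perm.mul_apply]
  congr 1
  generalize m / n = k
  induction k with
  | zero => simp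
  | succ k ih => rw [pow_succ, Perm.mul_apply, hret, ← ih]

theorem exists_first_return [Finite E] (σ : Perm E) (a b : E) :
    ∃ n, 0 < n ∧ ((σ ^ n) a = a ∨ (σ ^ n) a = b) ∧
      ∀ i, 0 < i → i < n → (σ ^ i) a ≠ a ∧ (σ ^ i) a ≠ b := by
  classical
  have hex : ∃ n, 0 < n ∧ ((σ ^ n) a = a ∨ (σ ^ n) a = b) :=
    ⟨orderOf σ, orderOf_pos σ, Or.inl (by rw [pow_orderOf_eq_one]; rfl)⟩
  refine ⟨Nat.find hex, (Nat.find_spec hex).1, (Nat.find_spec hex).2, fun i hi hin => ?_⟩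
  have := Nat.find_min hex hin
  tauto

variable [DecidableEq E]

/-- A predicate that takes the same value at `a` and `b` is invariant under `swap a b * σ` if it is
invariant under `σ`.  Orbits are compared throughout by testing them on invariant predicates. -/
theorem iff_swap_mul {σ : Perm E} {a b : E} {f : E → Prop} (hab : f a ↔ f b)
    (hf : ∀ x, f (σ x) ↔ f x) (x : E) : f ((swap a b * σ) x) ↔ f x := by
  rw [Perm.mul_apply, ← hf x]
  by_cases h1 : σ x = a
  · rw [h1, swap_apply_left, hab]
  · by_cases h2 : σ x = b
    · rw [h2, swap_apply_right, hab]
    · rw [swap_apply_of_ne_of_ne h1 h2]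

theorem swap_mul_swap_mul (σ : Perm E) (a b : E) : swap a b * (swap a b * σ) = σ := by
  rw [← mul_assoc, swap_mul_self, one_mul]

theorem iff_of_iff_swap_mul {σ : Perm E} {a b : E} {f : E → Prop} (hab : f a ↔ f b)
    (hf : ∀ x, f ((swap a b * σ) x) ↔ f x) (x : E) : f (σ x) ↔ f x := by
  have := iff_swap_mul hab hf x
  rwa [swap_mul_swap_mul] at this

/-- Composing with `swap a b` does not change an orbit before its first visit to `a` or `b`. -/
theorem pow_swap_mul_apply {σ : Perm E} {a b x : E} {n : ℕ}
    (h : ∀ i, 0 < i → i < n → (σ ^ i) x ≠ a ∧ (σ ^ i) x ≠ b) :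
    ∀ i < n, ((swap a b * σ) ^ i) x = (σ ^ i) x := by
  intro i
  induction i with
  | zero => simp
  | succ i ih =>
    intro hi
    rw [pow_succ', Perm.mul_apply, ih (by omega), Perm.mul_apply, ← Perm.mul_apply σ, ← pow_succ']
    exact swap_apply_of_ne_of_ne (h _ (by omega) hi).1 (h _ (by omega) hi).2

/-- Multiplying by the transposition of `a` and `b` splits their common cycle, or joins their two
cycles. -/
theorem sameCycle_swap_mul_iff [Finite E] {σ : Perm E} {a b : E} (hab : a ≠ b) :
    SameCycle (swap a b * σ) a b ↔ ¬ SameCycle σ a b := by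
  obtain ⟨n, hn, hret, hlt⟩ := exists_first_return σ a b
  have hpow := pow_swap_mul_apply hlt
  have hn' : ((swap a b * σ) ^ n) a = swap a b ((σ ^ n) a) := by
    obtain ⟨m, rfl⟩ : ∃ m, n = m + 1 := ⟨n - 1, by omega⟩
    rw [pow_succ', Perm.mul_apply, hpow m (by omega), Perm.mul_apply, ← Perm.mul_apply σ,
      ← pow_succ']
  have hne : ∀ i < n, (σ ^ i) a ≠ b := fun i hi => by
    rcases Nat.eq_zero_or_pos i with rfl | hi0
    · simpa using hab
    · exact (hlt i hi0 hi).2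
  rcases hret with hret | hret
  · rw [hret, swap_apply_left] at hn'
    exact iff_of_true ⟨n, by rw [zpow_natCast, hn']⟩ (not_sameCycle_of_return hn hret hne)
  · rw [hret, swap_apply_right] at hn'
    refine iff_of_false (not_sameCycle_of_return hn hn' fun i hi => ?_) 
      (not_not.mpr ⟨n, by rw [zpow_natCast, hret]⟩)
    rw [hpow i hi]
    exact hne i hi

theorem sameCycle_swap_mul_iff_or [Finite E] {σ : Perm E} {a b : E} (hab : ¬ SameCycle σ a b)
    (x y : E) : SameCycle (swap a b * σ) x y ↔ SameCycle σ x y ∨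
      ((SameCycle σ a x ∨ SameCycle σ b x) ∧ (SameCycle σ a y ∨ SameCycle σ b y)) := by
  have hne : a ≠ b := by rintro rfl; exact hab (SameCycle.refl _ _)
  have hm : SameCycle (swap a b * σ) a b := (sameCycle_swap_mul_iff hne).2 hab
  have hle : ∀ {x y}, SameCycle σ x y → SameCycle (swap a b * σ) x y := fun {x y} h =>
    (iff_of_sameCycle (f := fun z => SameCycle (swap a b * σ) x z)
      (iff_of_iff_swap_mul ⟨fun h => h.trans hm, fun h => h.trans hm.symm⟩
        fun z => sameCycle_apply_right) h).1 (SameCycle.refl _ _)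
  constructor
  · intro h
    let f : E → Prop := fun z => SameCycle σ x z ∨
      ((SameCycle σ a x ∨ SameCycle σ b x) ∧ (SameCycle σ a z ∨ SameCycle σ b z))
    refine (iff_of_sameCycle (f := f) (iff_swap_mul ?_ fun z => ?_) h).1 (Or.inl (SameCycle.refl _ _))
    · have h1 : SameCycle σ a a := SameCycle.refl _ _
      have h2 : SameCycle σ b b := SameCycle.refl _ _
      have h3 : SameCycle σ x a ↔ SameCycle σ a x := sameCycle_comm
      have h4 : SameCycle σ x b ↔ SameCycle σ b x := sameCycle_comm
      simp only [f]
      tauto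
    · simp only [f, sameCycle_apply_right]
  · have key : ∀ z, SameCycle σ a z ∨ SameCycle σ b z → SameCycle (swap a b * σ) a z := by
      rintro z (h | h)
      · exact hle h
      · exact hm.trans (hle h)
    rintro (h | ⟨h1, h2⟩)
    · exact hle h
    · exact (key x h1).symm.trans (key y h2)

/-- Multiplying by a transposition whose points lie on different cycles merges these two cycles. -/
theorem cycleCount_eq_swap_mul_add_one [Finite E] {σ : Perm E} {a b : E}
    (hab : ¬ SameCycle σ a b) : cycleCount σ = cycleCount (swap a b * σ) + 1 := by
  classical
  have hiff := sameCycle_swap_mul_iff_or hab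
  let q : E → Quotient (SameCycle.setoid σ) := Quotient.mk _
  have hq : ∀ {x y}, q x = q y ↔ SameCycle σ x y := fun {x y} => Quotient.eq
  let F : Quotient (SameCycle.setoid σ) → Quotient (SameCycle.setoid (swap a b * σ)) :=
    Quotient.map id fun x y h => (hiff x y).2 (Or.inl h)
  have hbij : Function.Bijective fun p : {p // p ≠ q b} => F p.1 := by
    constructor
    · rintro ⟨x, hx⟩ ⟨y, hy⟩ h
      induction x using Quotient.inductionOn with | _ x
      induction y using Quotient.inductionOn with | _ y
      have hx' : ¬ SameCycle σ b x := fun h => hx (hq.2 h.symm)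
      have hy' : ¬ SameCycle σ b y := fun h => hy (hq.2 h.symm)
      have h' : SameCycle (swap a b * σ) x y := Quotient.eq.1 h
      rw [hiff] at h'
      apply Subtype.ext
      apply hq.2
      rcases h' with h' | ⟨h1, h2⟩
      · exact h'
      · exact (h1.resolve_right hx').symm.trans (h2.resolve_right hy')
    · intro y
      induction y using Quotient.inductionOn with | _ y
      by_cases hy : SameCycle σ y b
      · refine ⟨⟨q a, fun h => hab (hq.1 h)⟩, Quotient.sound ?_⟩
        exact (hiff a y).2 (Or.inr ⟨Or.inl (SameCycle.refl _ _), Or.inr hy.symm⟩)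
      · exact ⟨⟨q y, fun h => hy (hq.1 h)⟩, rfl⟩
  have hcard := Nat.card_congr (Equiv.ofBijective _ hbij)
  rw [cycleCount, cycleCount, ← hcard]
  have := Fintype.ofFinite (Quotient (SameCycle.setoid σ))
  have hpos : 0 < Fintype.card (Quotient (SameCycle.setoid σ)) := Fintype.card_pos_iff.2 ⟨q b⟩
  rw [Nat.card_eq_fintype_card, Nat.card_eq_fintype_card, Fintype.card_subtype_compl,
    Fintype.card_subtype_eq]
  omega

end SwapCycles

end VirtualGraph

/-! ### The activity expansion of a state sum -/

namespace VirtualGraph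

section Expansion

open Equiv Equiv.Perm Function

/-- The combinatorial core of a 2-digraph with vertices `V` and edges `E`.  A state `S : V → Bool`
chooses one of the two smoothings at every vertex; `perm S` sends each edge to the next one on its
closed path.  The edges `fst v` and `snd v` are those that start at `v`, and changing the smoothing
at `v` exchanges them. -/
structure SmoothingFamily (V E : Type*) [DecidableEq V] [DecidableEq E] where
  perm : (V → Bool) → Perm E
  fst : V → E
  snd : V → E
  fst_ne_snd : ∀ v, fst v ≠ snd v
  perm_flip : ∀ S v, perm (update S v (!S v)) = swap (fst v) (snd v) * perm S

namespace SmoothingFamily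

variable {V E : Type*} [DecidableEq V] [DecidableEq E] (F : SmoothingFamily V E)

/-- Connectedness of the partially smoothed graph, in which the smoothings outside `U` are those of
`σ` and the vertices in `U` are kept.  It is encoded by testing all predicates on edges that are
constant on the closed paths of `σ` and on the pairs of edges that leave the vertices in `U`. -/
def Linked (σ : Perm E) (U : Finset V) : Prop :=
  ∀ f : E → Prop, (∀ x, f (σ x) ↔ f x) → (∀ u ∈ U, f (F.fst u) ↔ f (F.snd u)) →
    ∀ x y, f x → f y

variable {F}

theorem iff_perm_update {S : V → Bool} {v : V} {f : E → Prop} (hv : f (F.fst v) ↔ f (F.snd v))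
    (hf : ∀ x, f (F.perm S x) ↔ f x) (c : Bool) (x : E) : f (F.perm (update S v c) x) ↔ f x := by
  by_cases hc : c = S v
  · rw [hc, update_eq_self]
    exact hf x
  · obtain rfl : c = !S v := by simpa [Bool.eq_not] using hc
    rw [F.perm_flip]
    exact iff_swap_mul hv hf x

theorem iff_perm_of_agree {U : Finset V} {S S' : V → Bool} {f : E → Prop}
    (hU : ∀ u ∈ U, f (F.fst u) ↔ f (F.snd u)) (hS : ∀ v ∉ U, S v = S' v)
    (hf : ∀ x, f (F.perm S x) ↔ f x) (x : E) : f (F.perm S' x) ↔ f x := by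
  induction U using Finset.induction_on generalizing S with
  | empty =>
    obtain rfl : S = S' := funext fun v => hS v (Finset.notMem_empty v)
    exact hf x
  | insert u U hu ih =>
    refine ih (S := update S u (S' u)) (fun v hv => hU v (Finset.mem_insert_of_mem hv))
      (fun v hv => ?_) (iff_perm_update (hU u (Finset.mem_insert_self _ _)) hf _)
    by_cases hvu : v = u
    · rw [hvu, update_self]
    · rw [update_of_ne hvu]
      exact hS v (by simp [hvu, hv])

/-- Smoothings at vertices of `U` do not matter for `Linked _ U`. -/
theorem linked_congr {U : Finset V} {S S' : V → Bool} (hS : ∀ v ∉ U, S v = S' v) :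
    F.Linked (F.perm S) U ↔ F.Linked (F.perm S') U :=
  ⟨fun h f hf hU => h f (iff_perm_of_agree hU (fun v hv => (hS v hv).symm) hf) hU,
    fun h f hf hU => h f (iff_perm_of_agree hU hS hf) hU⟩

theorem linked_of_single [Finite E] {σ : Perm E} (h : ∀ x y, SameCycle σ x y) (U : Finset V) :
    F.Linked σ U :=
  fun _ hf _ x y => (iff_of_sameCycle hf (h x y)).1

theorem single_of_linked_empty {σ : Perm E} (h : F.Linked σ ∅) (x y : E) : SameCycle σ x y :=
  h (SameCycle σ x) (fun _ => sameCycle_apply_right) (by simp) x y (SameCycle.refl _ _)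

theorem not_sameCycle_of_not_linked [Finite E] {U : Finset V} {S : V → Bool} {v : V}
    (h : F.Linked (F.perm S) (insert v U)) (hn : ¬ F.Linked (F.perm S) U) :
    ¬ SameCycle (F.perm S) (F.fst v) (F.snd v) := by
  intro hs
  refine hn fun f hf hU => h f hf fun u hu => ?_
  rcases Finset.mem_insert.1 hu with rfl | hu
  · exact iff_of_sameCycle hf hs
  · exact hU u hu

/-- At most one of the two smoothings of a vertex disconnects a connected graph. -/
theorem linked_flip_of_not_linked [Finite E] {U : Finset V} {S : V → Bool} {v : V}
    (h : F.Linked (F.perm S) (insert v U)) (hn : ¬ F.Linked (F.perm S) U) :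
    F.Linked (F.perm (update S v (!S v))) U := by
  intro f hf hU
  have hv : f (F.fst v) ↔ f (F.snd v) := by
    refine iff_of_sameCycle hf ?_
    rw [F.perm_flip, sameCycle_swap_mul_iff (F.fst_ne_snd v)]
    exact not_sameCycle_of_not_linked h hn
  refine h f (iff_of_iff_swap_mul hv (by rwa [← F.perm_flip])) fun u hu => ?_
  rcases Finset.mem_insert.1 hu with rfl | hu
  · exact hv
  · exact hU u hu

/-- In a state with one closed path, `v` interlaces with no vertex of `U` iff the other smoothing of
`v` disconnects the graph with vertices `U`: the two cycles of the smoothed path are then its two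
components. -/
theorem forall_sameCycle_iff_not_linked [Finite E] {U : Finset V} {S : V → Bool} (v : V)
    (hS : ∀ x y, SameCycle (F.perm S) x y) :
    (∀ u ∈ U, SameCycle (swap (F.fst v) (F.snd v) * F.perm S) (F.fst u) (F.snd u)) ↔
      ¬ F.Linked (swap (F.fst v) (F.snd v) * F.perm S) U := by
  set γ := swap (F.fst v) (F.snd v) * F.perm S with hγ
  have hsplit : ¬ SameCycle γ (F.fst v) (F.snd v) := by
    rw [hγ, sameCycle_swap_mul_iff (F.fst_ne_snd v), not_not]
    exact hS _ _
  constructor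
  · exact fun h hl => hsplit (hl (SameCycle γ (F.fst v)) (fun _ => sameCycle_apply_right)
      (fun u hu => ⟨fun h' => h'.trans (h u hu), fun h' => h'.trans (h u hu).symm⟩) _ _
      (SameCycle.refl _ _))
  · intro hn u hu
    by_contra hne
    -- the two cycles of `γ` are those of `F.fst v` and of `F.snd v`
    have hcover : ∀ z, SameCycle γ (F.fst v) z ∨ SameCycle γ (F.snd v) z := by
      intro z
      let g : E → Prop := fun z => SameCycle γ (F.fst v) z ∨ SameCycle γ (F.snd v) z
      have hg : ∀ x, g (F.perm S x) ↔ g x := by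
        refine iff_of_iff_swap_mul (a := F.fst v) (b := F.snd v) (f := g)
          (iff_of_true (Or.inl (SameCycle.refl _ _)) (Or.inr (SameCycle.refl _ _))) fun x => ?_
        simp only [g]
        rw [← hγ, sameCycle_apply_right, sameCycle_apply_right]
      exact (iff_of_sameCycle hg (hS (F.fst v) z)).1 (Or.inl (SameCycle.refl _ _))
    refine hn fun f hf hU => ?_
    have hu' := hU u hu
    have hv : f (F.fst v) ↔ f (F.snd v) := by
      have hL := fun {z w} => iff_of_sameCycle (x := z) (y := w) hf
      rcases hcover (F.fst u) with h1 | h1 <;> rcases hcover (F.snd u) with h2 | h2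
      · exact absurd (h1.symm.trans h2) hne
      · rw [hL h1, hu', ← hL h2]
      · rw [hL h1, hu', ← hL h2]
      · exact absurd (h1.symm.trans h2) hne
    intro x y hx
    have h3 := iff_of_iff_swap_mul (f := f) hv hf
    exact (iff_of_sameCycle h3 (hS x y)).1 hx

variable {R : Type*} [CommRing R] (F)

/-- The vertex `v` is live in the state `S` among the vertices of `U`.  That `u` and `v` interlace is
encoded by saying that the edges leaving `u` are on different closed paths once the smoothing at `v`
is changed; see `VirtualGraph.Coloring.EulerCircuit.interlaced_iff`. -/
def Live (ℓ : V → ℕ) (U : Finset V) (S : V → Bool) (v : V) : Prop :=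
  ∀ u ∈ U, u ≠ v →
    ¬ SameCycle (swap (F.fst v) (F.snd v) * F.perm S) (F.fst u) (F.snd u) → ℓ v < ℓ u

open Classical in
/-- The weight of `v` in the activity expansion: that of its smoothing, to which a live vertex adds
`δ` times the weight of the other smoothing. -/
noncomputable def activityWeight (w : V → Bool → R) (δ : R) (ℓ : V → ℕ) (U : Finset V)
    (S : V → Bool) (v : V) : R :=
  if F.Live ℓ U S v then w v (S v) + δ * w v (!S v) else w v (S v)

variable {F}

theorem live_insert_iff {ℓ : V → ℕ} {U : Finset V} {v u : V} (hlt : ℓ u < ℓ v)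
    (S : V → Bool) : F.Live ℓ (insert v U) S u ↔ F.Live ℓ U S u := by
  constructor
  · exact fun h x hx => h x (Finset.mem_insert_of_mem hx)
  · intro h x hx hxu hs
    rcases Finset.mem_insert.1 hx with rfl | hx
    · exact hlt
    · exact h x hx hxu hs

/-- The vertex with the largest label is live iff its other smoothing disconnects. -/
theorem live_insert_self_iff [Finite E] {ℓ : V → ℕ} {U : Finset V} {v : V} (hv : v ∉ U)
    (hlt : ∀ u ∈ U, ℓ u < ℓ v) {S : V → Bool} (hS : ∀ x y, SameCycle (F.perm S) x y) :
    F.Live ℓ (insert v U) S v ↔ ¬ F.Linked (F.perm (update S v (!S v))) U := by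
  rw [F.perm_flip, ← forall_sameCycle_iff_not_linked v hS]
  constructor
  · intro h u hu
    by_contra hs
    have hne : u ≠ v := fun h => hv (h ▸ hu)
    exact lt_asymm (hlt u hu) (h u (Finset.mem_insert_of_mem hu) hne hs)
  · intro h u hu hne hs
    exact absurd (h u (Finset.mem_of_mem_insert_of_ne hu hne)) hs

variable [Fintype V]

/-- The states that agree with `S₀` outside `U`. -/
def statesOver (U : Finset V) (S₀ : V → Bool) : Finset (V → Bool) :=
  {S | ∀ v ∉ U, S v = S₀ v}

omit [DecidableEq E] in
theorem mem_statesOver {U : Finset V} {S₀ S : V → Bool} :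
    S ∈ statesOver U S₀ ↔ ∀ v ∉ U, S v = S₀ v := by
  simp [statesOver]

theorem sum_statesOver_insert {U : Finset V} {v : V} (hv : v ∉ U) (S₀ : V → Bool)
    (g : (V → Bool) → R) : ∑ S ∈ statesOver (insert v U) S₀, g S =
      ∑ c : Bool, ∑ S ∈ statesOver U (update S₀ v c), g S := by
  rw [← Finset.sum_fiberwise (statesOver (insert v U) S₀) (fun S => S v)]
  refine Finset.sum_congr rfl fun c _ => Finset.sum_congr ?_ fun _ _ => rfl
  ext S
  rw [Finset.mem_filter, mem_statesOver, mem_statesOver]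
  constructor
  · rintro ⟨h, rfl⟩ u hu
    by_cases huv : u = v
    · rw [huv, update_self]
    · rw [update_of_ne huv]
      exact h u (by simp [huv, hu])
  · intro h
    refine ⟨fun u hu => ?_, by simpa using h v hv⟩
    rw [Finset.mem_insert, not_or] at hu
    simpa [update_of_ne hu.1] using h u hu.2

variable (F) in
/-- The bracket state sum over the smoothings of the vertices in `U`: each closed path counts `δ`. -/
noncomputable def stateSum (w : V → Bool → R) (δ : R) (U : Finset V) (S₀ : V → Bool) : R :=
  ∑ S ∈ statesOver U S₀, (∏ u ∈ U, w u (S u)) * δ ^ cycleCount (F.perm S)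

variable (F) in
open Classical in
/-- The sum of the activity weights over the states with a single closed path, that is, over the
Euler circuits. -/
noncomputable def circuitExpansion (w : V → Bool → R) (δ : R) (ℓ : V → ℕ) (U : Finset V)
    (S₀ : V → Bool) : R :=
  ∑ S ∈ statesOver U S₀, if ∀ x y, SameCycle (F.perm S) x y then
    ∏ u ∈ U, F.activityWeight w δ ℓ U S u else 0

theorem apply_of_mem_statesOver {U : Finset V} {v : V} (hv : v ∉ U) {S₀ S : V → Bool} {c : Bool}
    (h : S ∈ statesOver U (update S₀ v c)) : S v = c := by
  simpa using mem_statesOver.1 h v hv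

theorem stateSum_insert {U : Finset V} {v : V} (hv : v ∉ U) (S₀ : V → Bool) (w : V → Bool → R)
    (δ : R) : F.stateSum w δ (insert v U) S₀ =
      ∑ c : Bool, w v c * F.stateSum w δ U (update S₀ v c) := by
  rw [stateSum, sum_statesOver_insert hv]
  refine Finset.sum_congr rfl fun c _ => ?_
  rw [stateSum, Finset.mul_sum]
  refine Finset.sum_congr rfl fun S hS => ?_
  rw [Finset.prod_insert hv, apply_of_mem_statesOver hv hS, mul_assoc]

theorem update_mem_statesOver {U : Finset V} {v : V} {S₀ S : V → Bool} {c : Bool}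
    (c' : Bool) (h : S ∈ statesOver U (update S₀ v c)) :
    update S v c' ∈ statesOver U (update S₀ v c') := by
  rw [mem_statesOver] at h ⊢
  intro u hu
  by_cases huv : u = v
  · simp [huv]
  · simpa [huv] using h u hu

/-- If a smoothing of `v` disconnects the graph, every state with this smoothing has one closed path
more than the corresponding state with the other smoothing. -/
theorem stateSum_update_of_not_linked [Finite E] {U : Finset V} {v : V} (hv : v ∉ U)
    {S₀ : V → Bool} {c : Bool} (w : V → Bool → R) (δ : R)
    (h : F.Linked (F.perm (update S₀ v c)) (insert v U))
    (hn : ¬ F.Linked (F.perm (update S₀ v c)) U) :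
    F.stateSum w δ U (update S₀ v c) = δ * F.stateSum w δ U (update S₀ v !c) := by
  rw [stateSum, stateSum, Finset.mul_sum]
  refine Finset.sum_bij' (fun S _ => update S v !c) (fun S _ => update S v c)
    (fun S hS => update_mem_statesOver _ hS) (fun S hS => update_mem_statesOver _ hS)
    (fun S hS => ?_) (fun S hS => ?_) fun S hS => ?_
  · rw [update_idem, ← apply_of_mem_statesOver hv hS, update_eq_self]
  · rw [update_idem, ← apply_of_mem_statesOver hv hS, update_eq_self]
  · have hSv := apply_of_mem_statesOver hv hS
    have hS' := mem_statesOver.1 hS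
    have hnS : ¬ SameCycle (F.perm S) (F.fst v) (F.snd v) := by
      apply not_sameCycle_of_not_linked (U := U)
      · rwa [linked_congr fun u hu => hS' u fun h => hu (Finset.mem_insert_of_mem h)]
      · rwa [linked_congr hS']
    rw [← hSv, F.perm_flip, cycleCount_eq_swap_mul_add_one hnS, pow_succ]
    have : ∏ u ∈ U, w u (update S v (!S v) u) = ∏ u ∈ U, w u (S u) :=
      Finset.prod_congr rfl fun u hu => by
        rw [update_of_ne fun h : u = v => hv (h ▸ hu)]
    rw [this]
    ring

theorem circuitExpansion_insert [Finite E] {ℓ : V → ℕ} {U : Finset V} {v : V} (hv : v ∉ U)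
    (hlt : ∀ u ∈ U, ℓ u < ℓ v) (S₀ : V → Bool) (w : V → Bool → R) (δ : R) :
    F.circuitExpansion w δ ℓ (insert v U) S₀ =
      ∑ c : Bool, (open Classical in if F.Linked (F.perm (update S₀ v !c)) U then w v c
        else w v c + δ * w v !c) * F.circuitExpansion w δ ℓ U (update S₀ v c) := by
  classical
  rw [circuitExpansion, sum_statesOver_insert hv]
  refine Finset.sum_congr rfl fun c _ => ?_
  rw [circuitExpansion, Finset.mul_sum]
  refine Finset.sum_congr rfl fun S hS => ?_
  by_cases hs : ∀ x y, SameCycle (F.perm S) x y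
  · rw [if_pos hs, if_pos hs, Finset.prod_insert hv]
    congr 1
    · have hSv := apply_of_mem_statesOver hv hS
      have := linked_congr (F := F) (mem_statesOver.1 (update_mem_statesOver (!c) hS))
      rw [activityWeight, live_insert_self_iff hv hlt hs, hSv, this]
      by_cases hl : F.Linked (F.perm (update S₀ v !c)) U
      · rw [if_neg (not_not.2 hl), if_pos hl]
      · rw [if_pos hl, if_neg hl]
    · refine Finset.prod_congr rfl fun u hu => ?_
      simp only [activityWeight, live_insert_iff (hlt u hu)]
  · rw [if_neg hs, if_neg hs, mul_zero]

theorem circuitExpansion_eq_zero [Finite E] {ℓ : V → ℕ} {U : Finset V} {S₀ : V → Bool}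
    (w : V → Bool → R) (δ : R) (hn : ¬ F.Linked (F.perm S₀) U) :
    F.circuitExpansion w δ ℓ U S₀ = 0 := by
  refine Finset.sum_eq_zero fun S hS => if_neg fun h => hn ?_
  rw [← linked_congr (mem_statesOver.1 hS)]
  exact linked_of_single h U

/-- The state sum of a connected graph is `δ` times its activity expansion.  The vertices are
resolved in the order of decreasing labels; a vertex both of whose smoothings leave the graph
connected becomes dead, and any other one becomes live. -/
theorem stateSum_eq_mul_circuitExpansion [Finite E] [Nonempty E] {ℓ : V → ℕ}
    (hℓ : Injective ℓ) (w : V → Bool → R) (δ : R) (U : Finset V) (S₀ : V → Bool)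
    (h : F.Linked (F.perm S₀) U) :
    F.stateSum w δ U S₀ = δ * F.circuitExpansion w δ ℓ U S₀ := by
  classical
  induction U using Finset.induction_on_max_value ℓ generalizing S₀ with
  | empty =>
    have hs := single_of_linked_empty h
    have hc : cycleCount (F.perm S₀) = 1 := by
      rw [cycleCount, Nat.card_eq_one_iff_unique]
      refine ⟨⟨fun x y => ?_⟩, ‹Nonempty E›.map (Quotient.mk _)⟩
      induction x using Quotient.inductionOn
      induction y using Quotient.inductionOn
      exact Quotient.sound (hs _ _)
    have hst : statesOver ∅ S₀ = {S₀} := by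
      ext S
      simp [mem_statesOver, funext_iff]
    rw [stateSum, circuitExpansion, hst, Finset.sum_singleton, Finset.sum_singleton, if_pos hs, hc]
    simp
  | insert v U hv hle ih =>
    have hlt : ∀ u ∈ U, ℓ u < ℓ v := fun u hu =>
      lt_of_le_of_ne (hle u hu) fun h => hv (hℓ h ▸ hu)
    have hU : ∀ c, F.Linked (F.perm (update S₀ v c)) (insert v U) := fun c => by
      rwa [linked_congr (S' := S₀)]
      intro u hu
      exact update_of_ne (fun h : u = v => hu (h ▸ Finset.mem_insert_self _ _)) _ _
    have hflip : ∀ c, ¬ F.Linked (F.perm (update S₀ v c)) U →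
        F.Linked (F.perm (update S₀ v !c)) U := fun c hc => by
      simpa using linked_flip_of_not_linked (hU c) hc
    rw [stateSum_insert hv, circuitExpansion_insert hv hlt]
    -- a smoothing of `v` that disconnects contributes `δ` times the other one
    have key : ∀ c, ¬ F.Linked (F.perm (update S₀ v c)) U →
        w v c * F.stateSum w δ U (update S₀ v c) + w v (!c) * F.stateSum w δ U (update S₀ v !c) =
        δ * ((w v (!c) + δ * w v c) * F.circuitExpansion w δ ℓ U (update S₀ v !c)) := by
      intro c hc
      rw [stateSum_update_of_not_linked hv w δ (hU c) hc, ih _ (hflip c hc)]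
      ring
    rw [Fintype.sum_bool, Fintype.sum_bool, Bool.not_true, Bool.not_false]
    by_cases ht : F.Linked (F.perm (update S₀ v true)) U
    · by_cases hf : F.Linked (F.perm (update S₀ v false)) U
      · rw [if_pos ht, if_pos hf, ih _ ht, ih _ hf]
        ring
      · rw [if_neg hf, if_pos ht, circuitExpansion_eq_zero w δ hf, add_comm, mul_zero, add_zero]
        exact key false hf
    · have hf := hflip true ht
      rw [Bool.not_true] at hf
      rw [if_pos hf, if_neg ht, circuitExpansion_eq_zero w δ ht, mul_zero, zero_add]
      exact key true ht

end SmoothingFamily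

end Expansion

end VirtualGraph

/-! ### Interlacement of points on a cycle -/

namespace VirtualGraph.Coloring

open Equiv Equiv.Perm Function

section ChordDiagram

variable {E : Type*} [DecidableEq E] [Finite E]

omit [DecidableEq E] in
theorem exists_pow_apply_eq {σ : Perm E} (hσ : ∀ x y, SameCycle σ x y) (a b : E) :
    ∃ n < Nat.card E, (σ ^ n) a = b := by
  have := Fintype.ofFinite E
  have h : σ.IsCycleOn (Finset.univ : Finset E) := by
    rw [Finset.coe_univ]
    exact ⟨Set.bijOn_univ.2 σ.bijective, fun x _ y _ => hσ x y⟩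
  rw [Nat.card_eq_fintype_card]
  exact h.exists_pow_eq (Finset.mem_univ a) (Finset.mem_univ b)

omit [DecidableEq E] in
theorem pow_apply_injOn {σ : Perm E} (hσ : ∀ x y, SameCycle σ x y) {a : E} {m n : ℕ}
    (hm : m < Nat.card E) (hn : n < Nat.card E) (h : (σ ^ m) a = (σ ^ n) a) : m = n := by
  have := Fintype.ofFinite E
  have hc : σ.IsCycleOn (Finset.univ : Finset E) := by
    rw [Finset.coe_univ]
    exact ⟨Set.bijOn_univ.2 σ.bijective, fun x _ y _ => hσ x y⟩
  rw [hc.pow_apply_eq_pow_apply (Finset.mem_univ a), Finset.card_univ,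
    ← Nat.card_eq_fintype_card] at h
  exact h.eq_of_lt_of_lt hm hn

/-- Multiplying a cycle by the transposition of two of its points cuts it into the two arcs between
them. -/
theorem sameCycle_arc {σ : Perm E} (hσ : ∀ x y, SameCycle σ x y) {a : E} {i j : ℕ}
    (hj : j < Nat.card E) (hi : i < Nat.card E) :
    (i < j → SameCycle (swap a ((σ ^ j) a) * σ) a ((σ ^ i) a)) ∧
    (j ≤ i → SameCycle (swap a ((σ ^ j) a) * σ) ((σ ^ j) a) ((σ ^ i) a)) := by
  have hinj := fun {m n : ℕ} => pow_apply_injOn hσ (a := a) (m := m) (n := n)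
  constructor
  · intro hij
    refine ⟨i, ?_⟩
    rw [zpow_natCast]
    refine pow_swap_mul_apply (fun m hm hmj => ⟨fun h => ?_, fun h => ?_⟩) i hij
    · exact hm.ne' (hinj (by omega) (by omega) (by simpa using h))
    · exact hmj.ne (hinj (by omega) (by omega) h)
  · intro hij
    refine ⟨(i - j : ℕ), ?_⟩
    have hadd : ∀ m, (σ ^ m) ((σ ^ j) a) = (σ ^ (m + j)) a := fun m => by
      rw [pow_add, Perm.mul_apply]
    rw [zpow_natCast, pow_swap_mul_apply (n := Nat.card E - j), hadd, Nat.sub_add_cancel hij]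
    · refine fun m hm hmj => ⟨fun h => ?_, fun h => ?_⟩
      · rw [hadd] at h
        have := hinj (m := m + j) (n := 0) (by omega) (by omega) (by simpa using h)
        omega
      · rw [hadd] at h
        have := hinj (m := m + j) (n := j) (by omega) (by omega) h
        omega
    · omega

end ChordDiagram

/-! ### States of a colored graph -/

variable {V : Type*} {G : VirtualGraph V} (c : G.Coloring)

theorem left_add_one (v : V) (k : ZMod 4) : c.left (v, k + 1) = !c.left (v, k) :=
  c.left_next v k

theorem left_sub_one (v : V) (k : ZMod 4) : c.left (v, k - 1) = !c.left (v, k) := by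
  have := c.left_next v (k - 1)
  rw [sub_add_cancel] at this
  rw [this, Bool.not_not]

theorem left_add_two (v : V) (k : ZMod 4) : c.left (v, k + 2) = c.left (v, k) := by
  rw [← one_add_one_eq_two, ← add_assoc, left_add_one, left_add_one, Bool.not_not]

theorem zmod_four_cases (k l : ZMod 4) : l = k ∨ l = k + 2 ∨ l = k + 1 ∨ l = k - 1 := by
  revert k l; decide

theorem eq_or_eq_add_two {v : V} {k l : ZMod 4} (h : c.left (v, l) = c.left (v, k)) :
    l = k ∨ l = k + 2 := by
  rcases zmod_four_cases k l with rfl | rfl | rfl | rfl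
  · exact Or.inl rfl
  · exact Or.inr rfl
  · simp [left_add_one] at h
  · simp [left_sub_one] at h

theorem eq_add_one_or_sub_one {v : V} {k l : ZMod 4} (h : c.left (v, l) = !c.left (v, k)) :
    l = k + 1 ∨ l = k - 1 := by
  rcases zmod_four_cases k l with rfl | rfl | rfl | rfl
  · simp at h
  · simp [left_add_two] at h
  · exact Or.inl rfl
  · exact Or.inr rfl

/-- The half-edge into which a path that arrives along `d` turns in the state `S`.  A path oriented by
the coloring arrives with `c.left d = false`; then `S v = true` is the turn from position `k` to
`k + 1`, which cuts off an uncolored corner and has its marker on the colored side.  For the reverse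
orientation the same corners are cut off, so that `turn S` is an involution. -/
def turn (S : V → Bool) (d : V × ZMod 4) : V × ZMod 4 :=
  (d.1, d.2 + if c.left d = S d.1 then -1 else 1)

theorem left_turn (S : V → Bool) (d : V × ZMod 4) : c.left (c.turn S d) = !c.left d := by
  obtain ⟨v, k⟩ := d
  unfold turn
  split_ifs
  · rw [← sub_eq_add_neg, left_sub_one]
  · rw [left_add_one]

theorem turn_turn (S : V → Bool) (d : V × ZMod 4) : c.turn S (c.turn S d) = d := by
  have h := c.left_turn S d
  have h1 : (c.turn S d).1 = d.1 := rfl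
  have h2 : (c.turn S d).2 = d.2 + if c.left d = S d.1 then -1 else 1 := rfl
  rw [turn, h, h1, h2]
  ext
  · rfl
  · cases c.left d <;> cases S d.1 <;> simp

/-- The permutation of the edges that describes the state `S`, a system of closed directed paths:
an edge is followed by the one into which it turns at its end. -/
def smoothing (S : V → Bool) : Perm c.Edge where
  toFun e := ⟨c.turn S (G.mate e.1), by rw [left_turn, c.left_mate, e.2]; rfl⟩
  invFun e := ⟨G.mate (c.turn S e.1), by rw [c.left_mate, left_turn, e.2]; rfl⟩
  left_inv e := Subtype.ext (by simp only [turn_turn, G.mate_mate])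
  right_inv e := Subtype.ext (by simp only [turn_turn, G.mate_mate])

variable {c}

theorem smoothing_start (S : V → Bool) (e : c.Edge) :
    (c.smoothing S e).start = c.turn S e.finish := rfl

theorem Edge.left_start (e : c.Edge) : c.left e.start = true := e.2

theorem Edge.left_finish (e : c.Edge) : c.left e.finish = false := by
  rw [Edge.finish, c.left_mate, e.2]; rfl

theorem Edge.ext_start {e e' : c.Edge} (h : e.start = e'.start) : e = e' := Subtype.ext h

theorem Edge.ext_finish {e e' : c.Edge} (h : e.finish = e'.finish) : e = e' := by
  apply Edge.ext_start
  rw [Edge.finish, Edge.finish] at h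
  rw [Edge.start, Edge.start, ← G.mate_mate e.1, h, G.mate_mate]

variable (c)

instance [DecidableEq V] : DecidableEq c.Edge :=
  inferInstanceAs (DecidableEq {d : V × ZMod 4 // c.left d = true})

instance [Finite V] : Finite c.Edge :=
  inferInstanceAs (Finite {d : V × ZMod 4 // c.left d = true})

/-- One of the two edges that start at `v`. -/
def firstEdge (v : V) : c.Edge :=
  ⟨(v, if c.left (v, 0) = true then 0 else 1), by
    split_ifs with h
    · exact h
    · have := c.left_add_one v 0
      rw [zero_add] at this
      simpa [this] using h⟩

/-- The other edge that starts at `v`. -/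
def secondEdge (v : V) : c.Edge :=
  ⟨(v, (c.firstEdge v).start.2 + 2), by
    rw [left_add_two]; exact (c.firstEdge v).2⟩

theorem firstEdge_ne_secondEdge (v : V) : c.firstEdge v ≠ c.secondEdge v := by
  intro h
  have h' : (c.firstEdge v).start.2 = (c.firstEdge v).start.2 + 2 :=
    congrArg (fun e => e.start.2) h
  have h2 : (2 : ZMod 4) ≠ 0 := by decide
  exact h2 (by simpa using h')

variable {c}

theorem Edge.eq_firstEdge_or (e : c.Edge) :
    e = c.firstEdge e.start.1 ∨ e = c.secondEdge e.start.1 := by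
  have h : c.left (e.start.1, e.start.2) = c.left (e.start.1, (c.firstEdge e.start.1).start.2) :=
    e.left_start.trans (c.firstEdge e.start.1).left_start.symm
  rcases c.eq_or_eq_add_two h with h | h
  · exact Or.inl (Edge.ext_start (Prod.ext rfl h))
  · exact Or.inr (Edge.ext_start (Prod.ext rfl h))

theorem eq_firstEdge_secondEdge {v : V} {e e' : c.Edge} (hne : e ≠ e') (he : e.start.1 = v)
    (he' : e'.start.1 = v) : (e = c.firstEdge v ∧ e' = c.secondEdge v) ∨
      (e = c.secondEdge v ∧ e' = c.firstEdge v) := by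
  have h := e.eq_firstEdge_or
  have h' := e'.eq_firstEdge_or
  rw [he] at h
  rw [he'] at h'
  rcases h with h | h <;> rcases h' with h' | h'
  · exact absurd (h.trans h'.symm) hne
  · exact Or.inl ⟨h, h'⟩
  · exact Or.inr ⟨h, h'⟩
  · exact absurd (h.trans h'.symm) hne

theorem swap_firstEdge_secondEdge [DecidableEq V] {v : V} {e e' : c.Edge} (hne : e ≠ e')
    (he : e.start.1 = v) (he' : e'.start.1 = v) :
    swap (c.firstEdge v) (c.secondEdge v) = swap e e' := by
  rcases eq_firstEdge_secondEdge hne he he' with ⟨rfl, rfl⟩ | ⟨rfl, rfl⟩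
  · rfl
  · exact swap_comm _ _

variable (c)

/-- The states of a colored graph as a smoothing family. -/
def smoothingFamily [DecidableEq V] : SmoothingFamily V c.Edge where
  perm := c.smoothing
  fst := c.firstEdge
  snd := c.secondEdge
  fst_ne_snd := c.firstEdge_ne_secondEdge
  perm_flip S v := by
    ext1 e
    rw [Perm.mul_apply]
    by_cases hv : e.finish.1 = v
    · have hne : c.smoothing S e ≠ c.smoothing (update S v !S v) e := by
        intro h
        have h' := congrArg (fun e => e.start.2) h
        simp only [smoothing_start, turn, hv, update_self, add_right_inj] at h'
        have h2 : (1 : ZMod 4) ≠ -1 := by decide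
        cases hl : c.left e.finish <;> cases hS : S v <;> simp_all
      rw [swap_firstEdge_secondEdge hne (by exact hv) (by exact hv), swap_apply_left]
    · have h1 : c.smoothing (update S v !S v) e = c.smoothing S e := by
        apply Edge.ext_start
        rw [smoothing_start, smoothing_start, turn, turn, update_of_ne hv]
      rw [h1, swap_apply_of_ne_of_ne]
      · exact fun h => hv (congrArg (fun e => e.start.1) h)
      · exact fun h => hv (congrArg (fun e => e.start.1) h)

variable {c}

/-! ### Euler circuits as states with a single closed path -/

namespace EulerCircuit

theorem markerColored_iff {S : V → Bool} {γ : c.EulerCircuit} (h : γ.next = c.smoothing S)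
    (v : V) : γ.MarkerColored v ↔ S v = true := by
  have hturn : ∀ e : c.Edge, (γ.next e).start.2 = e.finish.2 + 1 ↔ S e.finish.1 = true := by
    intro e
    have h2 : (-1 : ZMod 4) ≠ 1 := by decide
    rw [h, smoothing_start, turn, e.left_finish]
    cases S e.finish.1 <;> simp [h2]
  constructor
  · rintro ⟨e, rfl, he⟩
    exact (hturn e).1 he
  · intro hS
    let e : c.Edge := (⟨G.mate (v, (c.firstEdge v).start.2 + 1), by
      rw [c.left_mate, left_add_one, Bool.not_not]; exact (c.firstEdge v).2⟩ : {d // c.left d = true})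
    have he : e.finish.1 = v := by
      simp only [e, Edge.finish, G.mate_mate]
    exact ⟨e, he, (hturn e).2 (he ▸ hS)⟩

open Classical in
/-- An Euler circuit is determined by its markers: on both visits to a vertex it makes the same kind
of turn. -/
theorem next_eq_smoothing (γ : c.EulerCircuit) :
    γ.next = c.smoothing fun v => decide (γ.MarkerColored v) := by
  ext1 e
  apply Edge.ext_start
  have hl : c.left ((e.finish).1, (γ.next e).start.2) = !c.left (e.finish.1, e.finish.2) := by
    rw [← γ.start_next]
    exact (γ.next e).left_start.trans (by rw [γ.start_next]; exact (congrArg Bool.not e.left_finish).symm)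
  rw [smoothing_start, turn]
  refine Prod.ext (γ.start_next e) ?_
  rw [e.left_finish]
  change (γ.next e).start.2 = e.finish.2 + _
  by_cases hm : γ.MarkerColored e.finish.1
  · simp only [hm, decide_true, Bool.false_eq_true, if_false]
    refine (c.eq_add_one_or_sub_one hl).resolve_right fun h => ?_
    obtain ⟨e', hv, he'⟩ := hm
    have hl' : c.left (e.finish.1, e'.finish.2) = c.left (e.finish.1, e.finish.2) := by
      rw [← hv]
      exact e'.left_finish.trans (by rw [hv]; exact e.left_finish.symm)
    rcases c.eq_or_eq_add_two hl' with h' | h'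
    · rw [Edge.ext_finish (Prod.ext hv h'), h] at he'
      have h2 : (-1 : ZMod 4) ≠ 1 := by decide
      rw [sub_eq_add_neg, add_right_inj] at he'
      exact h2 he'
    · -- otherwise the two edges that end at the vertex would be followed by the same edge
      have : γ.next e = γ.next e' := by
        apply Edge.ext_start
        refine Prod.ext ?_ ?_
        · rw [γ.start_next, γ.start_next, hv]
        · rw [h, he', h']
          have h3 : (2 : ZMod 4) + 1 = -1 := by decide
          rw [add_assoc, h3, sub_eq_add_neg]
      rw [γ.next.injective this] at h'
      have h2 : (2 : ZMod 4) ≠ 0 := by decide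
      exact h2 (by simpa using h')
  · simp only [hm, decide_false, if_true]
    rw [← sub_eq_add_neg]
    exact (c.eq_add_one_or_sub_one hl).resolve_left fun h => hm ⟨e, rfl, h⟩

theorem ext_next {γ γ' : c.EulerCircuit} (h : γ.next = γ'.next) : γ = γ' := by
  cases γ; cases γ'; congr

variable (c) in
/-- Euler circuits correspond to the states with a single closed path. -/
noncomputable def equivState :
    {S : V → Bool // ∀ x y, SameCycle (c.smoothing S) x y} ≃ c.EulerCircuit := by
  classical
  exact
  { toFun := fun S =>
      ⟨c.smoothing S.1, ⟨Set.bijOn_univ.2 (c.smoothing S.1).bijective, fun x _ y _ => S.2 x y⟩,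
        fun e => rfl⟩
    invFun := fun γ => ⟨fun v => decide (γ.MarkerColored v), fun x y => by
      rw [← γ.next_eq_smoothing]
      exact γ.isCycleOn.2 (Set.mem_univ x) (Set.mem_univ y)⟩
    left_inv := fun S => Subtype.ext <| funext fun v => by
      rw [Bool.eq_iff_iff, decide_eq_true_iff]
      exact markerColored_iff rfl v
    right_inv := fun γ => ext_next γ.next_eq_smoothing.symm }

theorem equivState_next (S : {S : V → Bool // ∀ x y, SameCycle (c.smoothing S) x y}) :
    (equivState c S).next = c.smoothing S.1 := rfl

theorem sameCycle (γ : c.EulerCircuit) (x y : c.Edge) : SameCycle γ.next x y :=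
  γ.isCycleOn.2 (Set.mem_univ x) (Set.mem_univ y)

/-- Two vertices interlace iff the edges leaving one of them are separated by changing the smoothing
at the other one. -/
theorem interlaced_iff [DecidableEq V] [Finite V] (γ : c.EulerCircuit) (v u : V) :
    γ.Interlaced v u ↔ u ≠ v ∧ ¬ SameCycle (swap (c.firstEdge v) (c.secondEdge v) * γ.next)
      (c.firstEdge u) (c.secondEdge u) := by
  have hinj := fun {a : c.Edge} {m n : ℕ} => pow_apply_injOn γ.sameCycle (a := a) (m := m) (n := n)
  constructor
  · rintro ⟨hne, e, i, j, k, hi, hij, hjk, hk, hv, hu, hv', hu'⟩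
    refine ⟨hne.symm, fun hs => ?_⟩
    have h1 : e ≠ (γ.next ^ j) e := fun h => by
      have := hinj (a := e) (m := j) (n := 0) (by omega) (by omega) (by simpa using h.symm)
      omega
    have h2 : (γ.next ^ i) e ≠ (γ.next ^ k) e := fun h => by
      have := hinj (by omega) (by omega) h
      omega
    rw [swap_firstEdge_secondEdge h1 hv hv'] at hs
    have hs' : SameCycle (swap e ((γ.next ^ j) e) * γ.next) ((γ.next ^ i) e) ((γ.next ^ k) e) := by
      rcases eq_firstEdge_secondEdge h2 hu hu' with ⟨h, h'⟩ | ⟨h, h'⟩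
      · rwa [h, h']
      · rw [h, h']
        exact hs.symm
    have hi' := (sameCycle_arc γ.sameCycle (a := e) (j := j) (i := i) (by omega) (by omega)).1 hij
    have hk' := (sameCycle_arc γ.sameCycle (a := e) (j := j) (i := k) (by omega) hk).2 hjk.le
    exact (sameCycle_swap_mul_iff h1).1 ((hi'.trans hs').trans hk'.symm) (γ.sameCycle _ _)
  · rintro ⟨hne, hs⟩
    obtain ⟨j, hj, hje⟩ := exists_pow_apply_eq γ.sameCycle (c.firstEdge v) (c.secondEdge v)
    obtain ⟨i, hi, hie⟩ := exists_pow_apply_eq γ.sameCycle (c.firstEdge v) (c.firstEdge u)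
    obtain ⟨k, hk, hke⟩ := exists_pow_apply_eq γ.sameCycle (c.firstEdge v) (c.secondEdge u)
    have hi' := sameCycle_arc γ.sameCycle (a := c.firstEdge v) hj hi
    have hk' := sameCycle_arc γ.sameCycle (a := c.firstEdge v) hj hk
    have hvu : ∀ e e' : c.Edge, e.start.1 = v → e'.start.1 = u → e ≠ e' := by
      rintro e e' rfl rfl rfl
      exact hne rfl
    have h0 : ∀ m w, (γ.next ^ m) (c.firstEdge v) = w → w.start.1 = u → 0 < m := by
      intro m w hm hw
      rcases Nat.eq_zero_or_pos m with rfl | h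
      · exact absurd hm (hvu _ _ rfl hw)
      · exact h
    have hj' : ∀ m w, (γ.next ^ m) (c.firstEdge v) = w → w.start.1 = u → m ≠ j := by
      rintro m w hm hw rfl
      exact hvu _ _ rfl hw (hje.symm.trans hm)
    rw [hje, hie] at hi'
    rw [hje, hke] at hk'
    have hi0 := h0 _ _ hie rfl
    have hk0 := h0 _ _ hke rfl
    have hij := hj' _ _ hie rfl
    have hkj := hj' _ _ hke rfl
    refine ⟨hne.symm, c.firstEdge v, ?_⟩
    by_cases h1 : i < j
    · have h2 : ¬ k < j := fun h2 => hs ((hi'.1 h1).symm.trans (hk'.1 h2))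
      exact ⟨i, j, k, hi0, h1, by omega, hk, rfl, by rw [hie]; rfl, by rw [hje]; rfl,
        by rw [hke]; rfl⟩
    · have h2 : k < j := by
        by_contra h2
        exact hs ((hi'.2 (by omega)).symm.trans (hk'.2 (by omega)))
      exact ⟨k, j, i, hk0, h2, by omega, hi, rfl, by rw [hke]; rfl, by rw [hje]; rfl,
        by rw [hie]; rfl⟩

end EulerCircuit

end VirtualGraph.Coloring

/-! ### The circuit sum of a connected graph as a state sum -/

namespace VirtualGraph.Coloring

open Equiv Equiv.Perm Function LaurentPolynomial

section CircuitSum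

variable {V : Type*} {G : VirtualGraph V} (c : G.Coloring)

/-- The value of a closed path of a state. -/
noncomputable def circleValue : LaurentPolynomial ℤ := -(T 2 + T (-2))

theorem circleValue_ne_zero : circleValue ≠ 0 := by
  intro h
  have h2 := congrArg (fun p : LaurentPolynomial ℤ => p.coeff 2) h
  norm_num [circleValue, AddMonoidAlgebra.coeff_neg, AddMonoidAlgebra.coeff_add, T_apply] at h2

/-- The weight of a smoothing at `v`, where `b = true` means that the marker is on the colored side:
`q` for the markers `A` and `b`, and `q⁻¹` for `a` and `B`. -/
noncomputable def smoothingWeight (s : V → ℤˣ) (v : V) (b : Bool) : LaurentPolynomial ℤ :=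
  if s v = 1 ↔ b = true then T 1 else T (-1)

variable {c}

theorem EulerCircuit.live_iff [DecidableEq V] [Fintype V] {S : V → Bool} {γ : c.EulerCircuit}
    (h : γ.next = c.smoothing S) (ℓ : V ↪ ℕ) (v : V) :
    γ.Live ℓ v ↔ c.smoothingFamily.Live ℓ Finset.univ S v := by
  have hp : c.smoothingFamily.perm S = γ.next := h.symm
  simp only [EulerCircuit.Live, SmoothingFamily.Live, γ.interlaced_iff, hp, Finset.mem_univ,
    true_imp_iff, and_imp]
  rfl

/-- The eight activity weights: for instance `q + q⁻¹ * (-(q ^ 2 + q ^ (-2))) = -q ^ (-3)` for a live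
marker `A`. -/
theorem EulerCircuit.weight_letter [DecidableEq V] [Fintype V] {S : V → Bool} {γ : c.EulerCircuit}
    (h : γ.next = c.smoothing S) (s : V → ℤˣ) (ℓ : V ↪ ℕ) (v : V) :
    (γ.letter s ℓ v).weight = c.smoothingFamily.activityWeight (smoothingWeight s) circleValue ℓ
      Finset.univ S v := by
  have e1 : (T 2 + T (-2) : LaurentPolynomial ℤ) * T (-1) = T 1 + T (-3) := by
    rw [add_mul, ← T_add, ← T_add]; norm_num
  have e2 : (T 2 + T (-2) : LaurentPolynomial ℤ) * T 1 = T 3 + T (-1) := by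
    rw [add_mul, ← T_add, ← T_add]; norm_num
  simp only [EulerCircuit.letter, EulerCircuit.marker, SmoothingFamily.activityWeight,
    markerColored_iff h, smoothingWeight, circleValue, neg_mul]
  by_cases hl : γ.Live ℓ v
  · have hl' := (live_iff h ℓ v).1 hl
    by_cases hs : s v = 1 <;> cases S v <;>
      simp [hl, hl', hs, ActivityLetter.weight, e1, e2]
  · have hl' := mt (live_iff h ℓ v).2 hl
    by_cases hs : s v = 1 <;> cases S v <;> simp [hl, hl', hs, ActivityLetter.weight]

/-- The circuit sum of a connected graph is its state sum up to the factor `circleValue`; the right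
hand side does not involve the labeling. -/
theorem circleValue_mul_circuitSum_of_linked [DecidableEq V] [Fintype V] [Nonempty V]
    (h : ∀ S, c.smoothingFamily.Linked (c.smoothing S) Finset.univ) (s : V → ℤˣ) (ℓ : V ↪ ℕ) :
    circleValue * c.circuitSum s ℓ = ∑ S : V → Bool, (∏ v, smoothingWeight s v (S v)) *
      circleValue ^ cycleCount (c.smoothing S) := by
  classical
  have : Nonempty c.Edge := ‹Nonempty V›.map c.firstEdge
  have huniv : ∀ S₀ : V → Bool, SmoothingFamily.statesOver Finset.univ S₀ = Finset.univ :=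
    fun S₀ => Finset.eq_univ_of_forall fun S => SmoothingFamily.mem_statesOver.2
      fun v hv => absurd (Finset.mem_univ v) hv
  have key := SmoothingFamily.stateSum_eq_mul_circuitExpansion (F := c.smoothingFamily)
    ℓ.injective (smoothingWeight s) circleValue Finset.univ (fun _ => true) (h _)
  rw [SmoothingFamily.stateSum, SmoothingFamily.circuitExpansion, huniv] at key
  refine Eq.trans ?_ key.symm
  congr 1
  rw [circuitSum, ← finsum_comp_equiv (EulerCircuit.equivState c), finsum_eq_sum_of_fintype,
    ← Finset.sum_filter]
  rw [Finset.sum_subtype (p := fun S => ∀ x y, SameCycle (c.smoothingFamily.perm S) x y) _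
    fun S => (Finset.mem_filter.trans (and_iff_right (Finset.mem_univ S)))]
  refine Finset.sum_congr rfl fun S _ => ?_
  rw [EulerCircuit.weight, finprod_eq_prod_of_fintype]
  exact Finset.prod_congr rfl fun v _ =>
    EulerCircuit.weight_letter (EulerCircuit.equivState_next S) s ℓ v

end CircuitSum

/-! ### Unoriented closed paths of a state -/

section Circles

variable {V : Type*} {G : VirtualGraph V} (c : G.Coloring)

/-- Two half-edges are on the same closed path of the state `S`, regardless of the orientation: they
are not separated by a predicate that is invariant under passing to the other end of an edge and
under turning at a vertex. -/
def circleSetoid (S : V → Bool) : Setoid (V × ZMod 4) where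
  r x y := ∀ f : V × ZMod 4 → Prop, (∀ z, f (G.mate z) ↔ f z) → (∀ z, f (c.turn S z) ↔ f z) →
    (f x ↔ f y)
  iseqv := ⟨fun _ _ _ _ => Iff.rfl, fun h f h1 h2 => (h f h1 h2).symm,
    fun h h' f h1 h2 => (h f h1 h2).trans (h' f h1 h2)⟩

/-- The closed paths of a state can be counted without using the orientation given by the coloring. -/
theorem cycleCount_smoothing [Finite V] (S : V → Bool) :
    cycleCount (c.smoothing S) = Nat.card (Quotient (c.circleSetoid S)) := by
  classical
  have hmap : ∀ e e' : c.Edge, SameCycle (c.smoothing S) e e' →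
      c.circleSetoid S e.start e'.start := fun e e' h f h1 h2 =>
    iff_of_sameCycle (f := fun e : c.Edge => f e.start) (fun e => by
      rw [smoothing_start, h2, Edge.finish, h1]; rfl) h
  refine Nat.card_congr (Equiv.ofBijective (Quotient.map Edge.start hmap) ⟨?_, ?_⟩)
  · intro x y h
    induction x using Quotient.inductionOn with | _ x
    induction y using Quotient.inductionOn with | _ y
    -- a half-edge belongs to the edge that starts or that ends with it
    let f : V × ZMod 4 → Prop := fun z =>
      ∃ e : c.Edge, (e.start = z ∨ e.finish = z) ∧ SameCycle (c.smoothing S) x e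
    have hf1 : ∀ z, f z → f (G.mate z) := by
      rintro z ⟨e, rfl | rfl, he⟩
      · exact ⟨e, Or.inr rfl, he⟩
      · exact ⟨e, Or.inl (G.mate_mate _).symm, he⟩
    have hf2 : ∀ z, f z → f (c.turn S z) := by
      rintro z ⟨e, rfl | rfl, he⟩
      · refine ⟨(c.smoothing S).symm e, Or.inr ?_, sameCycle_symm_apply_right.2 he⟩
        exact G.mate_mate _
      · exact ⟨c.smoothing S e, Or.inl rfl, sameCycle_apply_right.2 he⟩
    have hx : f x.start := ⟨x, Or.inl rfl, SameCycle.refl _ _⟩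
    obtain ⟨e, he, hs⟩ := (Quotient.eq.1 h f (fun z => ⟨fun h => by
      simpa [G.mate_mate] using hf1 _ h, hf1 z⟩) (fun z => ⟨fun h => by
      simpa [turn_turn] using hf2 _ h, hf2 z⟩)).1 hx
    refine Quotient.sound (?_ : SameCycle _ x y)
    rcases he with he | he
    · rwa [Edge.ext_start he] at hs
    · have h1 := e.left_finish
      rw [he, y.left_start] at h1
      exact absurd h1 (by decide)
  · intro y
    induction y using Quotient.inductionOn with | _ y
    by_cases hy : c.left y = true
    · exact ⟨Quotient.mk _ (⟨y, hy⟩ : {d // c.left d = true}), rfl⟩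
    · refine ⟨Quotient.mk _ (⟨G.mate y, by rw [c.left_mate]; simpa using hy⟩ :
        {d // c.left d = true}), Quotient.sound fun f h1 _ => h1 y⟩

end Circles

/-! ### Isomorphisms and recolorings -/

section Isomorphism

variable {V W : Type*} {G : VirtualGraph V} {H : VirtualGraph W} (φ : G.Iso H)

theorem _root_.VirtualGraph.Iso.mate_apply_map (d : V × ZMod 4) :
    H.mate (φ.map d) = φ.map (G.mate d) :=
  φ.mate_map d.1 (G.mate d).1 d.2 (G.mate d).2 rfl

/-- The action of an isomorphism on half-edges, as a bijection. -/
noncomputable def _root_.VirtualGraph.Iso.halfEdgeEquiv : V × ZMod 4 ≃ W × ZMod 4 :=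
  Equiv.ofBijective φ.map <| by
    constructor
    · rintro ⟨v, k⟩ ⟨w, l⟩ h
      have h1 : v = w := φ.vert.injective (congrArg Prod.fst h)
      subst h1
      have h2 : (φ.dir v : ZMod 4) * k + φ.shift v = φ.dir v * l + φ.shift v := congrArg Prod.snd h
      rw [add_left_inj] at h2
      rw [(φ.dir v).mul_right_inj.1 h2]
    · rintro ⟨w, l⟩
      refine ⟨(φ.vert.symm w, ↑(φ.dir (φ.vert.symm w))⁻¹ * (l - φ.shift (φ.vert.symm w))), ?_⟩
      simp [Iso.map]

/-- `φ` respects the colorings `c` and `d` up to exchanging the colored and the uncolored corners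
at the vertices `v` with `ε v = true`.  Where `φ` reverses the cyclic order, the left and the right
side of a half-edge are interchanged. -/
def RespectsUpTo (c : G.Coloring) (d : H.Coloring) (ε : V → Bool) : Prop :=
  ∀ v k, d.left (φ.map (v, k)) = ((c.left (v, k) ^^ ε v) ^^ decide (φ.dir v = -1))

variable {φ} {c : G.Coloring} {d : H.Coloring} {ε : V → Bool}

theorem units_zmod_four (u : (ZMod 4)ˣ) : u = 1 ∨ u = -1 := by
  revert u; decide

theorem RespectsUpTo.turn_map (h : RespectsUpTo φ c d ε) {S : V → Bool} {S' : W → Bool}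
    (hS : ∀ v, S' (φ.vert v) = (S v ^^ ε v)) (x : V × ZMod 4) :
    d.turn S' (φ.map x) = φ.map (c.turn S x) := by
  obtain ⟨v, k⟩ := x
  have h1 : (φ.map (v, k)).1 = φ.vert v := rfl
  have h2 : (φ.map (v, k)).2 = φ.dir v * k + φ.shift v := rfl
  have h3 : (1 : (ZMod 4)ˣ) ≠ -1 := by decide
  rw [turn, h, h1, h2, hS]
  refine Prod.ext rfl ?_
  change _ = (φ.dir v : ZMod 4) * (k + if c.left (v, k) = S v then -1 else 1) + φ.shift v
  rcases units_zmod_four (φ.dir v) with h | h <;> rw [h] <;>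
    cases c.left (v, k) <;> cases S v <;> cases ε v <;> simp [h3] <;> ring

theorem RespectsUpTo.cycleCount_eq [Finite V] [Finite W] (h : RespectsUpTo φ c d ε)
    {S : V → Bool} {S' : W → Bool} (hS : ∀ v, S' (φ.vert v) = (S v ^^ ε v)) :
    cycleCount (c.smoothing S) = cycleCount (d.smoothing S') := by
  rw [cycleCount_smoothing, cycleCount_smoothing]
  refine Nat.card_congr (Quotient.congr φ.halfEdgeEquiv fun x y => ⟨fun hxy f h1 h2 => ?_,
    fun hxy f h1 h2 => ?_⟩)
  · refine hxy (fun z => f (φ.map z)) (fun z => ?_) fun z => ?_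
    · rw [← φ.mate_apply_map, h1]
    · rw [← h.turn_map hS, h2]
  · have hmap : ∀ z, φ.halfEdgeEquiv.symm (φ.map z) = z := φ.halfEdgeEquiv.symm_apply_apply
    have := hxy (fun z => f (φ.halfEdgeEquiv.symm z)) (fun z => ?_) fun z => ?_
    · simpa using this
    · obtain ⟨z, rfl⟩ := φ.halfEdgeEquiv.surjective z
      change f (φ.halfEdgeEquiv.symm (H.mate (φ.map z))) ↔ f (φ.halfEdgeEquiv.symm (φ.map z))
      rw [φ.mate_apply_map, hmap, hmap, h1]
    · obtain ⟨z, rfl⟩ := φ.halfEdgeEquiv.surjective z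
      change f (φ.halfEdgeEquiv.symm (d.turn S' (φ.map z))) ↔ f (φ.halfEdgeEquiv.symm (φ.map z))
      rw [h.turn_map hS, hmap, hmap, h2]

theorem RespectsUpTo.stateSum_eq [Fintype V] [Fintype W] [DecidableEq V] [DecidableEq W]
    (h : RespectsUpTo φ c d ε) {s : V → ℤˣ}
    {t : W → ℤˣ} (hst : ∀ v, t (φ.vert v) = if ε v = true then -s v else s v) :
    ∑ S : V → Bool, (∏ v, smoothingWeight s v (S v)) * circleValue ^ cycleCount (c.smoothing S) =
    ∑ S : W → Bool, (∏ v, smoothingWeight t v (S v)) * circleValue ^ cycleCount (d.smoothing S) := by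
  let Φ : (V → Bool) ≃ (W → Bool) :=
    { toFun := fun S w => (S (φ.vert.symm w) ^^ ε (φ.vert.symm w))
      invFun := fun S v => (S (φ.vert v) ^^ ε v)
      left_inv := fun S => by ext v; simp
      right_inv := fun S => by ext w; simp }
  refine Fintype.sum_equiv Φ _ _ fun S => ?_
  have hS : ∀ v, Φ S (φ.vert v) = (S v ^^ ε v) := fun v => by simp [Φ]
  rw [h.cycleCount_eq hS]
  congr 1
  refine Fintype.prod_equiv φ.vert _ _ fun v => ?_
  rw [smoothingWeight, smoothingWeight, hS, hst]
  have h3 : (-1 : ℤˣ) ≠ 1 := by decide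
  rcases Int.units_eq_one_or (s v) with h | h <;> rw [h] <;>
    cases S v <;> cases ε v <;> simp [h3]

end Isomorphism

/-! ### Reduction to connected components -/

section Components

variable {V : Type*} {G : VirtualGraph V} {c : G.Coloring}

theorem linked_of_preconnected [DecidableEq V] (hG : G.adjGraph.Preconnected) [Fintype V]
    (S : V → Bool) : c.smoothingFamily.Linked (c.smoothing S) Finset.univ := by
  intro f hf hU
  have hstart : ∀ e : c.Edge, f e ↔ f (c.firstEdge e.start.1) := by
    intro e
    rcases e.eq_firstEdge_or with h | h
    · rw [← h]
    · exact (iff_of_eq (congrArg f h)).trans (hU e.start.1 (Finset.mem_univ _)).symm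
  have hedge : ∀ e : c.Edge, f (c.firstEdge e.start.1) ↔ f (c.firstEdge e.finish.1) := by
    intro e
    rw [← hstart, ← hf e, hstart]
    rfl
  have hadj : ∀ u v, G.adjGraph.Adj u v → (f (c.firstEdge u) ↔ f (c.firstEdge v)) := by
    rintro u v ⟨-, k, rfl⟩
    by_cases hk : c.left (u, k) = true
    · exact hedge (⟨(u, k), hk⟩ : {d // c.left d = true})
    · have := hedge (⟨G.mate (u, k), by rw [c.left_mate]; simpa using hk⟩ : {d // c.left d = true})
      simp only [Edge.start, Edge.finish, G.mate_mate] at this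
      exact this.symm
  have hreach : ∀ u v, G.adjGraph.Reachable u v → (f (c.firstEdge u) ↔ f (c.firstEdge v)) := by
    rintro u v ⟨p⟩
    induction p with
    | nil => rfl
    | cons h _ ih => exact (hadj _ _ h).trans ih
  intro x y hx
  rw [hstart] at hx ⊢
  exact (hreach _ _ (hG _ _)).1 hx

theorem component_preconnected (K : G.Component) : (G.component K).adjGraph.Preconnected := by
  refine K.connected_toSimpleGraph.preconnected.mono fun u v h => ?_
  obtain ⟨hne, k, hk⟩ : u.1 ≠ v.1 ∧ ∃ k : ZMod 4, (G.mate (u.1, k)).1 = v.1 := h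
  exact ⟨fun h => hne (congrArg Subtype.val h), k, Subtype.ext hk⟩

theorem circleValue_mul_circuitSum_component [Finite V] (K : G.Component) [Fintype K.supp]
    [DecidableEq K.supp] (s : K.supp → ℤˣ) (ℓ : K.supp ↪ ℕ) :
    circleValue * (c.component K).circuitSum s ℓ =
      ∑ S : K.supp → Bool, (∏ v, smoothingWeight s v (S v)) *
        circleValue ^ cycleCount ((c.component K).smoothing S) := by
  have : Nonempty K.supp := K.nonempty_supp.to_subtype
  exact circleValue_mul_circuitSum_of_linked (linked_of_preconnected (component_preconnected K)) s ℓ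

variable {W : Type*} {H : VirtualGraph W}

/-- The isomorphism of the underlying simple graphs. -/
def _root_.VirtualGraph.Iso.adjIso (φ : G.Iso H) : G.adjGraph ≃g H.adjGraph where
  toEquiv := φ.vert
  map_rel_iff' {u v} := by
    refine and_congr φ.vert.injective.ne_iff ⟨?_, ?_⟩
    · rintro ⟨k, hk⟩
      obtain ⟨⟨u', l⟩, hl⟩ := φ.halfEdgeEquiv.surjective (φ.vert u, k)
      obtain rfl : u' = u := φ.vert.injective (congrArg Prod.fst hl)
      refine ⟨l, φ.vert.injective ?_⟩
      rw [← hk, ← hl]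
      exact (congrArg Prod.fst (φ.mate_apply_map (u', l))).symm
    · rintro ⟨k, rfl⟩
      exact ⟨(φ.map (u, k)).2, congrArg Prod.fst (φ.mate_apply_map (u, k))⟩

/-- The restriction of an isomorphism to a connected component. -/
def _root_.VirtualGraph.Iso.component (φ : G.Iso H) (K : G.Component) :
    (G.component K).Iso (H.component (φ.adjIso.connectedComponentEquiv K)) where
  vert := SimpleGraph.ConnectedComponent.isoEquivSupp φ.adjIso K
  dir v := φ.dir v.1
  shift v := φ.shift v.1
  mate_map v w k l h := by
    have h' : G.mate (v.1, k) = (w.1, l) :=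
      Prod.ext (congrArg (fun x => x.1.1) h) (congrArg (fun x => x.2) h)
    have := φ.mate_map v.1 w.1 k l h'
    exact Prod.ext (Subtype.ext (congrArg Prod.fst this)) (congrArg (fun x => x.2) this)

theorem RespectsUpTo.X_eq [Finite V] [Finite W] {φ : G.Iso H} {d : H.Coloring} {ε : V → Bool}
    (h : RespectsUpTo φ c d ε) {s : V → ℤˣ} {t : W → ℤˣ}
    (hst : ∀ v, t (φ.vert v) = if ε v = true then -s v else s v) (ℓ : V ↪ ℕ) (ℓ' : W ↪ ℕ) :
    c.X s ℓ = d.X t ℓ' := by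
  classical
  rw [X, X, Nat.card_congr φ.adjIso.connectedComponentEquiv,
    ← finprod_comp_equiv φ.adjIso.connectedComponentEquiv]
  congr 1
  refine finprod_congr fun K => mul_left_cancel₀ circleValue_ne_zero ?_
  have := Fintype.ofFinite K.supp
  have := Fintype.ofFinite (φ.adjIso.connectedComponentEquiv K).supp
  rw [circleValue_mul_circuitSum_component, circleValue_mul_circuitSum_component]
  exact RespectsUpTo.stateSum_eq (φ := φ.component K) (ε := fun v => ε v.1)
    (fun v k => h v.1 k) fun v => hst v.1

/-- The identity isomorphism. -/
def _root_.VirtualGraph.Iso.refl (G : VirtualGraph V) : G.Iso G where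
  vert := Equiv.refl V
  dir _ := 1
  shift _ := 0
  mate_map v w k l h := by simpa using h

/-- Any two colorings differ by exchanging the colored and the uncolored corners at some vertices. -/
theorem respectsUpTo_refl (c' : G.Coloring) :
    RespectsUpTo (Iso.refl G) c c' fun v => decide (c'.left (v, 0) ≠ c.left (v, 0)) := by
  have h3 : (1 : (ZMod 4)ˣ) ≠ -1 := by decide
  have h0 : ∀ v, c'.left (v, 0) = (c.left (v, 0) ^^ decide (c'.left (v, 0) ≠ c.left (v, 0))) := by
    intro v
    cases c'.left (v, 0) <;> cases c.left (v, 0) <;> rfl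
  have h1 : ∀ v k, c'.left (v, k) =
      (c.left (v, k) ^^ decide (c'.left (v, 0) ≠ c.left (v, 0))) →
      c'.left (v, k + 1) = (c.left (v, k + 1) ^^ decide (c'.left (v, 0) ≠ c.left (v, 0))) := by
    intro v k h
    rw [left_add_one, left_add_one, h, Bool.not_xor]
  intro v k
  have hk : c'.left (v, k) = (c.left (v, k) ^^ decide (c'.left (v, 0) ≠ c.left (v, 0))) := by
    obtain ⟨n, rfl⟩ := ZMod.natCast_zmod_surjective k
    induction n with
    | zero => simpa using h0 v
    | succ n ih => rw [Nat.cast_succ]; exact h1 v n ih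
  have hmap : (Iso.refl G).map (v, k) = (v, k) := by simp [Iso.map, Iso.refl]
  rw [hmap, hk]
  simp [Iso.refl, h3]

/-- If `φ` takes colored corners to colored corners and reverses the cyclic order at `v`, then the
corner following a half-edge at `v` becomes the corner preceding its image, whence the exchange of
left and right. -/
theorem _root_.VirtualGraph.Iso.PreservesColoring.respectsUpTo {φ : G.Iso H} {d : H.Coloring}
    (h : φ.PreservesColoring c d) : RespectsUpTo φ c d fun _ => false := by
  intro v k
  have h3 : (1 : (ZMod 4)ˣ) ≠ -1 := by decide
  have hne : ∀ x : ZMod 4, x ≠ x + 1 + 1 := by decide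
  have hc : c.ColoredCorner (v, k) (v, k + 1) ↔ c.left (v, k) = true := by
    simp [ColoredCorner, hne]
  have hd := (h (v, k) (v, k + 1)).trans hc
  have hv : ∀ l, (φ.map (v, l)) = (φ.vert v, φ.dir v * l + φ.shift v) := fun _ => rfl
  rcases units_zmod_four (φ.dir v) with hu | hu
  · have hk : φ.map (v, k + 1) = ((φ.map (v, k)).1, (φ.map (v, k)).2 + 1) := by
      rw [hv, hv, hu]
      refine Prod.ext rfl ?_
      simp only [Units.val_one]
      ring
    rw [hk] at hd
    simp only [ColoredCorner, hne, true_and, false_and, or_false, ← Bool.eq_iff_iff] at hd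
    simpa [hu, h3] using hd
  · have hk : φ.map (v, k) = ((φ.map (v, k + 1)).1, (φ.map (v, k + 1)).2 + 1) := by
      rw [hv, hv, hu]
      refine Prod.ext rfl ?_
      simp only [Units.val_neg, Units.val_one]
      ring
    rw [hk] at hd
    simp only [ColoredCorner, hne, true_and, false_and, false_or, ← Bool.eq_iff_iff] at hd
    rw [hk, left_add_one]
    simp [hd, hu]

end Components

end VirtualGraph.Coloring

/-- The polynomial `X_G(q)` of a vertex-signed checkerboard-colorable 2-digraph does not depend on
the labeling of the vertices, nor on the checkerboard coloring, and it is the same for isomorphic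
graphs (whatever the labelings). -/
theorem theorem3p1 {V : Type*} [Finite V] (G : VirtualGraph V) (c : G.Coloring) (s : V → ℤˣ) :
    (∀ ℓ ℓ' : V ↪ ℕ, c.X s ℓ = c.X s ℓ') ∧
    (∀ (c' : G.Coloring) (ℓ ℓ' : V ↪ ℕ), c.X s ℓ = c'.X (c.recolorSign c' s) ℓ') ∧
    (∀ {W : Type*} (H : VirtualGraph W) (d : H.Coloring) (t : W → ℤˣ) (φ : G.Iso H)
      (ℓ : V ↪ ℕ) (ℓ' : W ↪ ℕ), φ.PreservesColoring c d → (∀ v, t (φ.vert v) = s v) →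
      c.X s ℓ = d.X t ℓ') := by
  have recolor : ∀ (c' : G.Coloring) (ℓ ℓ' : V ↪ ℕ), c.X s ℓ = c'.X (c.recolorSign c' s) ℓ' := by
    refine fun c' ℓ ℓ' => (VirtualGraph.Coloring.respectsUpTo_refl c').X_eq (fun v => ?_) ℓ ℓ'
    rw [VirtualGraph.Coloring.recolorSign]
    by_cases h : c'.left (v, 0) = c.left (v, 0) <;> simp [h, VirtualGraph.Iso.refl]
  refine ⟨fun ℓ ℓ' => ?_, recolor, fun {W} H d t φ ℓ ℓ' h hst => ?_⟩
  · have hs : c.recolorSign c s = s := funext fun v => if_pos rfl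
    rw [recolor c ℓ ℓ', hs]
  · have : Finite W := Finite.of_equiv V φ.vert
    exact h.respectsUpTo.X_eq (by simpa using hst) ℓ ℓ'
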